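/- Let $G$ be a finite simple connected graph on $n\ge 4$ vertices with minimum degree $\delta\ge 2$. For vertices $u,v$ let $d_G(u,v)$ be their distance in $G$ and let $Tr(u)=\sum_{v\in V(G)}d_G(u,v)$ be the transmission of $u$. Let $\rho_D(G)$ be the largest eigenvalue of the distance signless Laplacian matrix $Q_D(G)=Tr(G)+\mathcal D(G)$, where $\mathcal D(G)=(d_G(u,v))_{u,v\in V(G)}$ is the distance matrix and $Tr(G)$ is the diagonal matrix of the transmissions. If $$\rho_D(G)\le\frac{2n^2+6n-28}{n},$$ then $G$ is traceable from every vertex, that is, for every vertex $x$ of $G$ there is a Hamilton path of $G$ starting at $x$. -/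

import Mathlib

noncomputable section

/-- The transmission of a vertex: the sum of its distances to all vertices of the graph. -/
def SimpleGraph.transmission {V : Type*} [Fintype V] (G : SimpleGraph V) (u : V) : ℕ :=
  ∑ v, G.dist u v

/-- The distance matrix, with real entries. -/
def SimpleGraph.distMatrix {V : Type*} (G : SimpleGraph V) : Matrix V V ℝ :=
  Matrix.of fun u v => (G.dist u v : ℝ)

/-- The distance signless Laplacian matrix: the diagonal matrix of the vertex transmissions plus
the distance matrix. -/
def SimpleGraph.distSignlessLaplacian {V : Type*} [Fintype V] [DecidableEq V]
    (G : SimpleGraph V) : Matrix V V ℝ :=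
  Matrix.diagonal (fun u => (G.transmission u : ℝ)) + G.distMatrix

/-- The distance signless Laplacian spectral radius: the largest eigenvalue of the distance
signless Laplacian matrix. That matrix is real symmetric, so for a nonempty finite vertex set
its eigenvalues form a nonempty finite set of reals and the supremum is a maximum. -/
def SimpleGraph.distSignlessSpectralRadius {V : Type*} [Fintype V] [DecidableEq V]
    (G : SimpleGraph V) : ℝ :=
  sSup {μ : ℝ | Module.End.HasEigenvalue (Matrix.toLin' G.distSignlessLaplacian) μ}

/-- A graph is traceable from `x` if it has a Hamilton path starting at `x`. -/
def SimpleGraph.TraceableFrom {V : Type*} [DecidableEq V] (G : SimpleGraph V) (x : V) : Prop :=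
  ∃ (y : V) (p : G.Walk x y), p.IsHamiltonian

end

/-!
A graph satisfying the hypotheses even has a Hamilton cycle, and cutting the cycle open at `x` gives
a Hamilton path from `x`.

Suppose that there is no Hamilton cycle, and let `n` be the number of vertices. Chvátal's theorem
(`exists_degree_le_of_forall_not_isCycleEnum`) yields some `h < n / 2`, a set `X` of `h` vertices of
degree at most `h`, and a set `Y` of `n - h` vertices of degree at most `n - h - 1`; here `h ≥ 2` by
the minimum degree hypothesis. Counting (`sum_degree_le_of_degree_le`) bounds the degree sum by
`n² - 5n + 14 + (h - 2)(3h + 7 - 2n)`.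

On the other hand, distinct non-adjacent vertices are at distance at least `2`, so the Rayleigh
quotients of the distance signless Laplacian at nonnegative vectors are bounded below in terms of
degrees and adjacencies (`Connected.rayleigh_le`). For the constant vector this says that the degree
sum is at least `n² - 5n + 14`. When `(h - 2)(3h + 7 - 2n) ≤ 0` the two bounds meet, and a vector
slightly larger on `X` has a Rayleigh quotient above the assumed bound: the extremal graphs, such as
the join of `K₂` with `K_{n-4} ∪ 2 K₁`, are not transmission regular. Otherwise `n = 2h + 1` with
`h = 3` or `h = 4`, where the extremal graph is the join of `K_h` with `h + 1` isolated vertices;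
there the vector with entries `2` on `Y` and `1` elsewhere gives the contradiction
(`sum_degree_le_of_finset` controls the edges inside `Y`).
-/

open Finset

namespace SimpleGraph

variable {V : Type*} [Fintype V]

/-! ### Spanning paths and cycles as enumerations of the vertices -/

/-- A spanning path of `G`, encoded as the sequence of its vertices. Only the values of `f` at
indices below the number of vertices matter. -/
structure IsPathEnum (G : SimpleGraph V) (f : ℕ → V) : Prop where
  inj : ∀ i < Fintype.card V, ∀ j < Fintype.card V, f i = f j → i = j
  adj : ∀ i, i + 1 < Fintype.card V → G.Adj (f i) (f (i + 1))

/-- A spanning cycle of `G`, encoded as a spanning path whose last vertex is adjacent to its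
first one. For at least three vertices this is a Hamilton cycle cut open at `f 0`. -/
structure IsCycleEnum (G : SimpleGraph V) (f : ℕ → V) : Prop extends G.IsPathEnum f where
  wrap : G.Adj (f (Fintype.card V - 1)) (f 0)

variable {G H : SimpleGraph V} {f : ℕ → V}

theorem IsPathEnum.exists_index (hf : G.IsPathEnum f) (v : V) :
    ∃ i < Fintype.card V, f i = v := by
  classical
  have hcard : ((range (Fintype.card V)).image f).card = Fintype.card V := by
    rw [card_image_of_injOn, card_range]
    intro i hi j hj h
    exact hf.inj i (by simpa using hi) j (by simpa using hj) h
  have hv : v ∈ (range (Fintype.card V)).image f := by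
    rw [(card_eq_iff_eq_univ _).1 hcard]
    exact mem_univ v
  simpa using hv

theorem IsCycleEnum.adj_mod (hf : G.IsCycleEnum f) {i : ℕ} (hi : i < Fintype.card V) :
    G.Adj (f i) (f ((i + 1) % Fintype.card V)) := by
  rcases Nat.lt_or_ge (i + 1) (Fintype.card V) with h | h
  · rw [Nat.mod_eq_of_lt h]
    exact hf.adj i h
  · obtain rfl : i = Fintype.card V - 1 := by omega
    rw [Nat.sub_add_cancel (by omega), Nat.mod_self]
    exact hf.wrap

theorem IsCycleEnum.rotate (hf : G.IsCycleEnum f) (s : ℕ) :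
    G.IsCycleEnum fun i => f ((i + s) % Fintype.card V) := by
  have hpos : 0 < Fintype.card V := Fintype.card_pos_iff.2 ⟨f 0⟩
  have hmod : ∀ i, (i + s) % Fintype.card V < Fintype.card V := fun i => Nat.mod_lt _ hpos
  have hadj : ∀ i, G.Adj (f ((i + s) % Fintype.card V)) (f ((i + 1 + s) % Fintype.card V)) := by
    intro i
    have h := hf.adj_mod (hmod i)
    rwa [Nat.mod_add_mod, add_right_comm] at h
  refine ⟨⟨fun i hi j hj h => ?_, fun i _ => hadj i⟩, ?_⟩
  · have h' : i ≡ j [MOD Fintype.card V] :=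
      Nat.ModEq.add_right_cancel' s (hf.inj _ (hmod i) _ (hmod j) h)
    exact Nat.ModEq.eq_of_lt_of_lt h' hi hj
  · have h := hadj (Fintype.card V - 1)
    rw [Nat.sub_add_cancel hpos, Nat.add_mod_left] at h
    simpa using h

theorem IsPathEnum.traceableFrom [DecidableEq V] (hf : G.IsPathEnum f) :
    G.TraceableFrom (f 0) := by
  have hpos : 0 < Fintype.card V := Fintype.card_pos_iff.2 ⟨f 0⟩
  have key : ∀ m < Fintype.card V, ∃ p : G.Walk (f 0) (f m),
      p.support = (List.range (m + 1)).map f := by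
    intro m
    induction m with
    | zero => exact fun _ => ⟨.nil, by simp⟩
    | succ m ih =>
      intro hm
      obtain ⟨p, hp⟩ := ih (by omega)
      refine ⟨p.concat (hf.adj m hm), ?_⟩
      rw [Walk.support_concat, hp, List.range_succ (n := m + 1), List.map_append]
      simp
  obtain ⟨p, hp⟩ := key (Fintype.card V - 1) (by omega)
  rw [Nat.sub_add_cancel hpos] at hp
  refine ⟨_, p, Walk.IsPath.isHamiltonian_of_mem (Walk.IsPath.mk' ?_) fun w => ?_⟩
  · rw [hp]
    refine List.Nodup.map_on (fun i hi j hj h => ?_) List.nodup_range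
    exact hf.inj i (by simpa using hi) j (by simpa using hj) h
  · obtain ⟨i, hi, rfl⟩ := hf.exists_index w
    rw [hp]
    exact List.mem_map.2 ⟨i, by simpa using hi, rfl⟩

theorem IsCycleEnum.traceableFrom [DecidableEq V] (hf : G.IsCycleEnum f) (x : V) :
    G.TraceableFrom x := by
  obtain ⟨i, hi, rfl⟩ := hf.exists_index x
  have h := (hf.rotate i).toIsPathEnum.traceableFrom
  rwa [zero_add, Nat.mod_eq_of_lt hi] at h

theorem exists_isCycleEnum_top (hn : 2 ≤ Fintype.card V) :
    ∃ f, (⊤ : SimpleGraph V).IsCycleEnum f := by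
  have : NeZero (Fintype.card V) := ⟨by omega⟩
  let f : ℕ → V := fun i => (Fintype.equivFin V).symm (Fin.ofNat (Fintype.card V) i)
  have hinj : ∀ i < Fintype.card V, ∀ j < Fintype.card V, f i = f j → i = j := by
    intro i hi j hj h
    have h' := congrArg Fin.val ((Fintype.equivFin V).symm.injective h)
    rwa [Fin.val_ofNat, Fin.val_ofNat, Nat.mod_eq_of_lt hi, Nat.mod_eq_of_lt hj] at h'
  refine ⟨f, ⟨hinj, fun i hi => ?_⟩, ?_⟩
  · rw [top_adj]
    intro h
    have := hinj i (by omega) _ hi h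
    omega
  · rw [top_adj]
    intro h
    have := hinj (Fintype.card V - 1) (by omega) 0 (by omega) h
    omega

/-! ### The crossing argument and Chvátal's degree condition -/

/-- If adding the edge `uv` creates a spanning cycle, cutting that cycle at `uv` leaves a spanning
path of the original graph with ends `u` and `v`. -/
theorem exists_isPathEnum_of_sup_edge (hn : 3 ≤ Fintype.card V) {u v : V}
    (hf : (H ⊔ edge u v).IsCycleEnum f) (hH : ∀ g, ¬ H.IsCycleEnum g) :
    ∃ g, H.IsPathEnum g ∧
      (g 0 = u ∧ g (Fintype.card V - 1) = v ∨ g 0 = v ∧ g (Fintype.card V - 1) = u) := by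
  have hcase : ∀ a b, (H ⊔ edge u v).Adj a b → ¬ H.Adj a b →
      (a = u ∧ b = v) ∨ (a = v ∧ b = u) := by
    intro a b h h'
    rw [sup_adj, edge_adj] at h
    tauto
  -- Some cyclically consecutive pair is the new edge; rotate so that it closes the cycle.
  obtain ⟨g, hg, hwrap⟩ : ∃ g, (H ⊔ edge u v).IsCycleEnum g ∧
      ¬ H.Adj (g (Fintype.card V - 1)) (g 0) := by
    by_contra! hcon
    have hstep : ∀ s, H.Adj (f ((Fintype.card V - 1 + s) % Fintype.card V))
        (f (s % Fintype.card V)) := by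
      intro s
      simpa using hcon _ (hf.rotate s)
    refine hH f ⟨⟨hf.inj, fun i hi => ?_⟩, ?_⟩
    · have h := hstep (i + 1)
      rw [show Fintype.card V - 1 + (i + 1) = Fintype.card V + i by omega, Nat.add_mod_left,
        Nat.mod_eq_of_lt hi, Nat.mod_eq_of_lt (by omega)] at h
      exact h
    · have h := hstep 0
      rwa [add_zero, Nat.zero_mod, Nat.mod_eq_of_lt (by omega)] at h
  have hends := hcase _ _ hg.wrap hwrap
  refine ⟨g, ⟨hg.inj, fun i hi => ?_⟩, by tauto⟩
  by_contra hnot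
  have hi' := hcase _ _ (hg.adj i hi) hnot
  have hinj := hg.inj
  rcases hends with ⟨h1, h2⟩ | ⟨h1, h2⟩ <;> rcases hi' with ⟨h3, h4⟩ | ⟨h3, h4⟩
  · have := hinj i (by omega) (Fintype.card V - 1) (by omega) (h3.trans h1.symm)
    omega
  · have := hinj i (by omega) 0 (by omega) (h3.trans h2.symm)
    have := hinj (i + 1) hi (Fintype.card V - 1) (by omega) (h4.trans h1.symm)
    omega
  · have := hinj i (by omega) 0 (by omega) (h3.trans h2.symm)
    have := hinj (i + 1) hi (Fintype.card V - 1) (by omega) (h4.trans h1.symm)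
    omega
  · have := hinj i (by omega) (Fintype.card V - 1) (by omega) (h3.trans h1.symm)
    omega

/-- The crossing argument: if `f 0` is adjacent to the successor of a neighbour `f i` of the last
vertex, then `f 0, …, f i, f (n - 1), f (n - 2), …, f (i + 1)` is a spanning cycle. -/
theorem IsPathEnum.exists_isCycleEnum (hf : H.IsPathEnum f) {i : ℕ}
    (hi : i + 1 < Fintype.card V) (h0 : H.Adj (f 0) (f (i + 1)))
    (h1 : H.Adj (f i) (f (Fintype.card V - 1))) : ∃ g, H.IsCycleEnum g := by
  refine ⟨fun j => if j ≤ i then f j else f (Fintype.card V + i - j),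
    ⟨fun a ha b hb h => ?_, fun j hj => ?_⟩, ?_⟩
  · split_ifs at h with h2 h3 h3
    · exact hf.inj a ha b hb h
    · have := hf.inj _ (by omega) _ (by omega) h
      omega
    · have := hf.inj _ (by omega) _ (by omega) h
      omega
    · have := hf.inj _ (by omega) _ (by omega) h
      omega
  · rcases lt_trichotomy j i with h | rfl | h
    · rw [if_pos h.le, if_pos (by omega)]
      exact hf.adj j hj
    · rw [if_pos le_rfl, if_neg (by omega)]
      rwa [show Fintype.card V + j - (j + 1) = Fintype.card V - 1 by omega]
    · rw [if_neg (by omega), if_neg (by omega)]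
      have := (hf.adj (Fintype.card V + i - (j + 1)) (by omega)).symm
      rwa [show Fintype.card V + i - (j + 1) + 1 = Fintype.card V + i - j by omega] at this
  · rw [if_neg (by omega), if_pos (by omega),
      show Fintype.card V + i - (Fintype.card V - 1) = i + 1 by omega]
    exact h0.symm

theorem IsPathEnum.degree_add_degree_lt [DecidableRel H.Adj] (hf : H.IsPathEnum f)
    (hH : ∀ g, ¬ H.IsCycleEnum g) :
    H.degree (f 0) + H.degree (f (Fintype.card V - 1)) < Fintype.card V := by
  classical
  have hpos : 0 < Fintype.card V := Fintype.card_pos_iff.2 ⟨f 0⟩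
  let S := (range (Fintype.card V - 1)).filter fun i => H.Adj (f 0) (f (i + 1))
  let T := (range (Fintype.card V - 1)).filter fun i => H.Adj (f i) (f (Fintype.card V - 1))
  have hS : H.degree (f 0) ≤ S.card := by
    rw [← card_neighborFinset_eq_degree]
    refine (card_le_card fun w hw => ?_).trans (card_image_le (s := S) (f := fun i => f (i + 1)))
    rw [mem_neighborFinset] at hw
    obtain ⟨i, hi, rfl⟩ := hf.exists_index w
    have hi0 : i ≠ 0 := by
      rintro rfl
      exact hw.ne rfl
    refine mem_image.2 ⟨i - 1, mem_filter.2 ⟨mem_range.2 (by omega), ?_⟩, ?_⟩ <;>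
      simp only [Nat.sub_add_cancel (Nat.pos_of_ne_zero hi0)]
    exact hw
  have hT : H.degree (f (Fintype.card V - 1)) ≤ T.card := by
    rw [← card_neighborFinset_eq_degree]
    refine (card_le_card fun w hw => ?_).trans (card_image_le (s := T) (f := f))
    rw [mem_neighborFinset] at hw
    obtain ⟨i, hi, rfl⟩ := hf.exists_index w
    have hi0 : i ≠ Fintype.card V - 1 := by
      rintro rfl
      exact hw.ne rfl
    exact mem_image.2 ⟨i, mem_filter.2 ⟨mem_range.2 (by omega), hw.symm⟩, rfl⟩
  have hST : Disjoint S T := by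
    rw [Finset.disjoint_left]
    intro i hiS hiT
    obtain ⟨hi, h0⟩ := mem_filter.1 hiS
    obtain ⟨_, h1⟩ := mem_filter.1 hiT
    obtain ⟨g, hg⟩ := hf.exists_isCycleEnum (by have := mem_range.1 hi; omega) h0 h1
    exact hH g hg
  have hle : (S ∪ T).card ≤ Fintype.card V - 1 := by
    rw [← card_range (Fintype.card V - 1)]
    exact card_le_card (union_subset (filter_subset _ _) (filter_subset _ _))
  rw [card_union_of_disjoint hST] at hle
  omega

/-- Chvátal's theorem in contrapositive form: a graph without a spanning cycle has, for some
`h < n / 2`, at least `h` vertices of degree at most `h` and at least `n - h` vertices of degree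
less than `n - h`. In a maximal supergraph without spanning cycle these are non-neighbours of
`v` and of `u`, for a non-adjacent pair `u, v` of largest degree sum. -/
theorem exists_degree_le_of_forall_not_isCycleEnum [DecidableRel G.Adj]
    (hn : 3 ≤ Fintype.card V) (hG : ∀ g, ¬ G.IsCycleEnum g) :
    ∃ (h : ℕ) (X Y : Finset V), G.minDegree ≤ h ∧ 2 * h < Fintype.card V ∧
      X.card = h ∧ (∀ w ∈ X, G.degree w ≤ h) ∧
      Y.card + h = Fintype.card V ∧ ∀ w ∈ Y, G.degree w + h < Fintype.card V := by
  classical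
  obtain ⟨H, hGH, hmax⟩ := Finite.exists_le_maximal (p := fun K : SimpleGraph V =>
    ∀ g, ¬ K.IsCycleEnum g) hG
  have hH : ∀ g, ¬ H.IsCycleEnum g := hmax.prop
  -- Every non-adjacent pair is joined by a spanning path, so its degree sum is less than `n`.
  have hpair : ∀ u v, u ≠ v → ¬ H.Adj u v → H.degree u + H.degree v < Fintype.card V := by
    intro u v huv hnadj
    have hex : ∃ f, (H ⊔ edge u v).IsCycleEnum f := by
      by_contra! hcon
      have hle := hmax.le_of_ge hcon le_sup_left
      exact hnadj (hle (by rw [sup_adj, edge_adj]; tauto))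
    obtain ⟨f, hf⟩ := hex
    obtain ⟨g, hg, h | h⟩ := exists_isPathEnum_of_sup_edge hn hf hH
    · have := hg.degree_add_degree_lt hH
      rwa [h.1, h.2] at this
    · have := hg.degree_add_degree_lt hH
      rw [h.1, h.2] at this
      omega
  let P : Finset (V × V) := univ.filter fun p => p.1 ≠ p.2 ∧ ¬ H.Adj p.1 p.2
  have hP : P.Nonempty := by
    by_contra hcon
    rw [not_nonempty_iff_eq_empty] at hcon
    have htop : H = ⊤ := by
      ext a b
      rw [top_adj]
      refine ⟨fun h => h.ne, fun hab => ?_⟩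
      by_contra hnot
      have : (a, b) ∈ P := mem_filter.2 ⟨mem_univ _, hab, hnot⟩
      rw [hcon] at this
      exact notMem_empty _ this
    obtain ⟨g, hg⟩ := exists_isCycleEnum_top (V := V) (by omega)
    exact hH g (htop ▸ hg)
  obtain ⟨⟨u, v⟩, hmem, hmaxP⟩ := exists_max_image P (fun p => H.degree p.1 + H.degree p.2) hP
  obtain ⟨-, huv, hnadj⟩ := mem_filter.1 hmem
  have hmaxdeg : ∀ a b, a ≠ b → ¬ H.Adj a b →
      H.degree a + H.degree b ≤ H.degree u + H.degree v := fun a b hab h =>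
    hmaxP (a, b) (mem_filter.2 ⟨mem_univ _, hab, h⟩)
  clear hmaxP hmem
  wlog hle : H.degree u ≤ H.degree v generalizing u v
  · exact this v u huv.symm (fun h => hnadj h.symm)
      (fun a b hab h => by rw [add_comm (H.degree v)]; exact hmaxdeg a b hab h) (by omega)
  have hsum := hpair u v huv hnadj
  have hGdeg : ∀ w, G.degree w ≤ H.degree w := fun w => by
    rw [← card_neighborFinset_eq_degree, ← card_neighborFinset_eq_degree]
    refine card_le_card fun x hx => ?_
    rw [mem_neighborFinset] at hx ⊢
    exact hGH hx
  have hcompl : ∀ w, (H.neighborFinset w)ᶜ.card + H.degree w = Fintype.card V := fun w => by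
    rw [card_compl, card_neighborFinset_eq_degree]
    have := H.degree_lt_card_verts w
    omega
  obtain ⟨X, hXsub, hXcard⟩ := exists_subset_card_eq
    (s := (H.neighborFinset v)ᶜ.erase v) (n := H.degree u) (by
      rw [card_erase_of_mem (by simp)]
      have := hcompl v
      omega)
  refine ⟨H.degree u, X, (H.neighborFinset u)ᶜ, (G.minDegree_le_degree u).trans (hGdeg u),
    by omega, hXcard, fun w hw => (hGdeg w).trans ?_, hcompl u, fun w hw => ?_⟩
  · have := hXsub hw
    rw [mem_erase, mem_compl, mem_neighborFinset] at this
    have := hmaxdeg w v this.1 fun h => this.2 h.symm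
    omega
  · rw [mem_compl, mem_neighborFinset] at hw
    have h1 := hGdeg w
    rcases eq_or_ne u w with rfl | hne
    · omega
    · have := hmaxdeg u w hne hw
      omega

end SimpleGraph

/-! ### Rayleigh quotients of the distance signless Laplacian -/

/-- The Rayleigh quotients of a real symmetric matrix are at most its largest eigenvalue. -/
theorem Matrix.IsHermitian.dotProduct_mulVec_le {ι : Type*} [Fintype ι] [DecidableEq ι]
    {A : Matrix ι ι ℝ} (hA : A.IsHermitian) (x : ι → ℝ) :
    x ⬝ᵥ A.mulVec x ≤ sSup {μ : ℝ | Module.End.HasEigenvalue (Matrix.toLin' A) μ} * (x ⬝ᵥ x) := by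
  set r := sSup {μ : ℝ | Module.End.HasEigenvalue (Matrix.toLin' A) μ} with hr
  have hle : ∀ μ ∈ spectrum ℝ A, μ ≤ r := by
    intro μ hμ
    rw [← Matrix.spectrum_toLin', ← Module.End.hasEigenvalue_iff_mem_spectrum] at hμ
    exact le_csSup (Module.End.finite_hasEigenvalue _).bddAbove hμ
  have hB : (algebraMap ℝ (Matrix ι ι ℝ) r - A).IsHermitian := by
    refine Matrix.IsHermitian.sub ?_ hA
    rw [Matrix.algebraMap_eq_diagonal]
    exact Matrix.isHermitian_diagonal _
  have hpos : (algebraMap ℝ (Matrix ι ι ℝ) r - A).PosSemidef := by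
    rw [hB.posSemidef_iff_eigenvalues_nonneg]
    intro i
    have hi := hB.eigenvalues_mem_spectrum_real i
    rw [← spectrum.singleton_sub_eq, Set.singleton_sub] at hi
    obtain ⟨μ, hμ, h⟩ := hi
    have := hle μ hμ
    simp only [Pi.zero_apply]
    rw [← h]
    exact sub_nonneg.2 this
  have h := hpos.dotProduct_mulVec_nonneg x
  rw [Matrix.sub_mulVec, dotProduct_sub, Algebra.algebraMap_eq_smul_one, Matrix.smul_mulVec,
    Matrix.one_mulVec, dotProduct_smul, smul_eq_mul, star_trivial] at h
  linarith

namespace SimpleGraph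

variable {V : Type*} [Fintype V] [DecidableEq V] {G : SimpleGraph V}

theorem isHermitian_distSignlessLaplacian : G.distSignlessLaplacian.IsHermitian := by
  refine (Matrix.isHermitian_diagonal _).add (Matrix.IsHermitian.ext fun i j => ?_)
  simp [distMatrix, dist_comm]

theorem dotProduct_distSignlessLaplacian_mulVec (x : V → ℝ) :
    x ⬝ᵥ G.distSignlessLaplacian.mulVec x =
      ∑ u, ∑ v, (G.dist u v : ℝ) * (x u ^ 2 + x u * x v) := by
  rw [distSignlessLaplacian, Matrix.add_mulVec, dotProduct_add]
  simp only [dotProduct, Matrix.mulVec_diagonal]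
  simp only [dotProduct, Matrix.mulVec, distMatrix, Matrix.of_apply, transmission, Nat.cast_sum]
  rw [← sum_add_distrib]
  refine sum_congr rfl fun u _ => ?_
  rw [sum_mul, mul_sum, mul_sum, ← sum_add_distrib]
  exact sum_congr rfl fun v _ => by ring

variable [DecidableRel G.Adj]

omit [Fintype V] in
/-- Distinct non-adjacent vertices are at distance at least `2`. -/
theorem Connected.two_sub_le_dist (hG : G.Connected) (u v : V) :
    (2 : ℝ) - (if u = v then 2 else 0) - (if G.Adj u v then 1 else 0) ≤ G.dist u v := by
  rcases eq_or_ne u v with rfl | huv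
  · simp
  · by_cases h : G.Adj u v
    · rw [dist_eq_one_iff_adj.2 h, if_neg huv, if_pos h]
      norm_num
    · have h1 := hG.pos_dist_of_ne huv
      have h2 : G.dist u v ≠ 1 := fun h' => h (dist_eq_one_iff_adj.1 h')
      rw [if_neg huv, if_neg h]
      have : (2 : ℝ) ≤ G.dist u v := by exact_mod_cast (by omega : 2 ≤ G.dist u v)
      linarith

/-! ### Counting adjacencies with a set of vertices -/

omit [DecidableEq V] in
theorem degree_eq_sum_ite (u : V) : (G.degree u : ℝ) = ∑ v, if G.Adj u v then 1 else 0 := by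
  rw [← card_neighborFinset_eq_degree, neighborFinset_eq_filter, sum_boole]

omit [DecidableEq V] in
/-- Twice the number of edges inside `A` is at most the sum of the degrees over `A`. -/
theorem sum_sum_adj_le_sum_degree (A : Finset V) :
    (∑ u ∈ A, ∑ v ∈ A, if G.Adj u v then (1 : ℝ) else 0) ≤ ∑ u ∈ A, (G.degree u : ℝ) := by
  refine sum_le_sum fun u _ => ?_
  rw [degree_eq_sum_ite]
  refine sum_le_sum_of_subset_of_nonneg (subset_univ _) fun v _ _ => ?_
  split_ifs <;> norm_num

/-- The edges inside the complement `B` of `A` contribute at most `|B| (|B| - 1)` to the sum of all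
degrees; the others are counted by the degrees of the vertices of `A`. -/
theorem sum_degree_le_of_finset (A : Finset V) :
    ∑ u, (G.degree u : ℝ) ≤ (Aᶜ.card : ℝ) * (Aᶜ.card - 1) + 2 * ∑ u ∈ A, (G.degree u : ℝ)
      - ∑ u ∈ A, ∑ v ∈ A, if G.Adj u v then (1 : ℝ) else 0 := by
  have hsplit : ∀ u, (G.degree u : ℝ) = (∑ v ∈ A, if G.Adj u v then (1 : ℝ) else 0)
      + ∑ v ∈ Aᶜ, if G.Adj u v then (1 : ℝ) else 0 := fun u => by
    rw [degree_eq_sum_ite, sum_add_sum_compl]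
  have hA : ∑ u ∈ A, (G.degree u : ℝ) = (∑ u ∈ A, ∑ v ∈ A, if G.Adj u v then (1 : ℝ) else 0)
      + ∑ u ∈ A, ∑ v ∈ Aᶜ, if G.Adj u v then (1 : ℝ) else 0 := by
    rw [← sum_add_distrib]
    exact sum_congr rfl fun u _ => hsplit u
  have hB : ∑ u ∈ Aᶜ, (G.degree u : ℝ) = (∑ u ∈ Aᶜ, ∑ v ∈ A, if G.Adj u v then (1 : ℝ) else 0)
      + ∑ u ∈ Aᶜ, ∑ v ∈ Aᶜ, if G.Adj u v then (1 : ℝ) else 0 := by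
    rw [← sum_add_distrib]
    exact sum_congr rfl fun u _ => hsplit u
  have hcross : (∑ u ∈ Aᶜ, ∑ v ∈ A, if G.Adj u v then (1 : ℝ) else 0)
      = ∑ u ∈ A, ∑ v ∈ Aᶜ, if G.Adj u v then (1 : ℝ) else 0 := by
    rw [sum_comm]
    simp only [G.adj_comm]
  have hBB : (∑ u ∈ Aᶜ, ∑ v ∈ Aᶜ, if G.Adj u v then (1 : ℝ) else 0)
      ≤ (Aᶜ.card : ℝ) * (Aᶜ.card - 1) := by
    rw [← nsmul_eq_mul]
    refine sum_le_card_nsmul _ _ _ fun u hu => ?_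
    rw [← add_sum_erase _ _ hu, if_neg (G.loopless.irrefl u), zero_add]
    calc (∑ v ∈ Aᶜ.erase u, if G.Adj u v then (1 : ℝ) else 0)
        ≤ ∑ v ∈ Aᶜ.erase u, 1 := sum_le_sum fun v _ => by split_ifs <;> norm_num
      _ = (Aᶜ.card : ℝ) - 1 := by
        rw [sum_const, nsmul_eq_mul, mul_one, cast_card_erase_of_mem hu]
  rw [← sum_add_sum_compl A]
  linarith

/-- The lower bound for the spectral radius given by the test vector equal to `1 + ε` on `A` and
`1` elsewhere, in terms of the degrees and of the number of edges inside `A`. -/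
theorem Connected.rayleigh_le (hG : G.Connected) (A : Finset V) {ε : ℝ} (hε : 0 ≤ ε) :
    4 * (Fintype.card V : ℝ) ^ 2 - 4 * Fintype.card V - 2 * ∑ u, (G.degree u : ℝ)
      + ε * ((8 * Fintype.card V - 8) * A.card - 4 * ∑ u ∈ A, (G.degree u : ℝ))
      + ε ^ 2 * ((2 * Fintype.card V - 4) * A.card + 2 * (A.card : ℝ) ^ 2
        - ∑ u ∈ A, (G.degree u : ℝ) - ∑ u ∈ A, ∑ v ∈ A, if G.Adj u v then (1 : ℝ) else 0)
    ≤ G.distSignlessSpectralRadius * (Fintype.card V + (2 * ε + ε ^ 2) * A.card) := by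
  let a : V → ℝ := fun u => if u ∈ A then 1 else 0
  let e : V → ℝ := fun u => ∑ v ∈ A, if G.Adj u v then (1 : ℝ) else 0
  let x : V → ℝ := fun u => 1 + ε * a u
  have haa : ∀ u, a u ^ 2 = a u := fun u => by simp [a]
  have hx : ∀ u, 0 ≤ x u := fun u => by
    have : 0 ≤ a u := by simp only [a]; split_ifs <;> norm_num
    positivity
  have hsa : ∑ u, a u = A.card := by simp [a]
  have hsum_mul : ∀ g : V → ℝ, ∑ u, a u * g u = ∑ u ∈ A, g u := fun g => by simp [a]
  have hse : ∑ u, e u = ∑ u ∈ A, (G.degree u : ℝ) := by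
    simp only [e]
    rw [sum_comm]
    exact sum_congr rfl fun v _ => by rw [degree_eq_sum_ite]; simp only [G.adj_comm]
  have hsx : ∑ u, x u = Fintype.card V + ε * A.card := by
    simp only [x]
    rw [sum_add_distrib, ← mul_sum, hsa]
    simp
  have hxx : x ⬝ᵥ x = Fintype.card V + (2 * ε + ε ^ 2) * A.card := by
    have h : ∀ u, x u * x u = 1 + (2 * ε + ε ^ 2) * a u := fun u => by
      simp only [x]
      linear_combination ε ^ 2 * haa u
    simp only [dotProduct, h]
    rw [sum_add_distrib, ← mul_sum, hsa]
    simp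
  have hadj : ∀ u, ∑ v, (if G.Adj u v then (1 : ℝ) else 0) * x v = G.degree u + ε * e u := by
    intro u
    have h : ∀ v, (if G.Adj u v then (1 : ℝ) else 0) * x v = (if G.Adj u v then (1 : ℝ) else 0)
        + ε * (a v * if G.Adj u v then (1 : ℝ) else 0) := fun v => by simp only [x]; ring
    simp only [h]
    rw [sum_add_distrib, ← mul_sum, hsum_mul, ← degree_eq_sum_ite]
  have hrow : ∀ u, ∑ v, ((2 : ℝ) - (if u = v then 2 else 0) - (if G.Adj u v then 1 else 0)) *
      (x u ^ 2 + x u * x v) = (4 * Fintype.card V - 4 - 2 * G.degree u + 2 * ε * A.card)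
        + ε * ((6 * Fintype.card V - 8) + 2 * ε * A.card) * a u - 3 * ε * (a u * G.degree u)
        + ε ^ 2 * (2 * Fintype.card V - 4) * a u - ε ^ 2 * (a u * G.degree u)
        - ε * e u - ε ^ 2 * (a u * e u) := by
    intro u
    have h : ∀ v, ((2 : ℝ) - (if u = v then 2 else 0) - (if G.Adj u v then 1 else 0)) *
        (x u ^ 2 + x u * x v) = 2 * x u ^ 2 + 2 * x u * x v
          - (if u = v then 2 * (x u ^ 2 + x u * x v) else 0)
          - x u ^ 2 * (if G.Adj u v then 1 else 0)
          - x u * ((if G.Adj u v then 1 else 0) * x v) := fun v => by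
      split_ifs <;> ring
    simp only [h]
    rw [sum_sub_distrib, sum_sub_distrib, sum_sub_distrib, sum_add_distrib, ← mul_sum, ← mul_sum,
      ← mul_sum, ← mul_sum, hadj, hsx, ← degree_eq_sum_ite, sum_ite_eq, if_pos (mem_univ u), sum_const,
      card_univ, nsmul_eq_mul]
    simp only [x]
    linear_combination ε ^ 2 * (2 * (Fintype.card V : ℝ) - 4 - G.degree u) * haa u
  have hlow : ∑ u, ∑ v, ((2 : ℝ) - (if u = v then 2 else 0) - (if G.Adj u v then 1 else 0)) *
      (x u ^ 2 + x u * x v) ≤ x ⬝ᵥ G.distSignlessLaplacian.mulVec x := by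
    rw [dotProduct_distSignlessLaplacian_mulVec]
    refine sum_le_sum fun u _ => sum_le_sum fun v _ => ?_
    exact mul_le_mul_of_nonneg_right (hG.two_sub_le_dist u v)
      (add_nonneg (sq_nonneg _) (mul_nonneg (hx u) (hx v)))
  have hray := isHermitian_distSignlessLaplacian (G := G).dotProduct_mulVec_le x
  rw [hxx] at hray
  refine le_trans (le_of_eq ?_) (hlow.trans hray)
  simp only [hrow]
  simp only [sum_add_distrib, sum_sub_distrib, ← mul_sum, hsum_mul, hsa, hse, sum_const,
    card_univ, nsmul_eq_mul]
  ring

/-! ### The degree sum of a graph without spanning cycle -/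

/-- The degree sum allowed by Chvátal's condition at `h`. -/
theorem sum_degree_le_of_degree_le {h : ℕ} {X Y : Finset V}
    (hX : X.card = h) (hXdeg : ∀ w ∈ X, G.degree w ≤ h) (hY : Y.card + h = Fintype.card V)
    (hYdeg : ∀ w ∈ Y, G.degree w + h < Fintype.card V) :
    ∑ u, (G.degree u : ℝ) ≤
      3 * (h : ℝ) ^ 2 - 2 * Fintype.card V * h + h + (Fintype.card V : ℝ) ^ 2 - Fintype.card V := by
  have h1 : ∑ u ∈ X, (G.degree u : ℝ) ≤ h * h := by
    have := sum_le_card_nsmul X (fun u => (G.degree u : ℝ)) h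
      fun w hw => by exact_mod_cast hXdeg w hw
    rwa [hX, nsmul_eq_mul] at this
  have h2 : ∑ u ∈ Xᶜ, (G.degree u : ℝ) ≤
      ∑ u ∈ Xᶜ, ((Fintype.card V : ℝ) - 1 - h * if u ∈ Y then 1 else 0) := by
    refine sum_le_sum fun u _ => ?_
    split_ifs with hu
    · have : (G.degree u : ℝ) + h + 1 ≤ Fintype.card V := by exact_mod_cast hYdeg u hu
      linarith
    · have : (G.degree u : ℝ) + 1 ≤ Fintype.card V := by
        exact_mod_cast G.degree_lt_card_verts u
      linarith
  have hXc : (Xᶜ.card : ℝ) = Fintype.card V - h := by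
    rw [card_compl, hX, Nat.cast_sub (by omega)]
  have h3 : ∑ u ∈ Xᶜ, ((Fintype.card V : ℝ) - 1 - h * if u ∈ Y then 1 else 0)
      = (Fintype.card V - h) * (Fintype.card V - 1) - h * (Xᶜ ∩ Y).card := by
    rw [sum_sub_distrib, sum_const, nsmul_eq_mul, hXc, ← mul_sum, sum_boole, filter_mem_eq_inter]
  have h4 : (Fintype.card V : ℝ) - 2 * h ≤ (Xᶜ ∩ Y).card := by
    have h5 : Y.card ≤ (Xᶜ ∩ Y).card + X.card := by
      refine (card_le_card fun w hw => ?_).trans (card_union_le (Xᶜ ∩ Y) X)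
      by_cases hwX : w ∈ X <;> simp [hw, hwX]
    have h6 : Fintype.card V ≤ (Xᶜ ∩ Y).card + 2 * h := by omega
    have h7 : (Fintype.card V : ℝ) ≤ (Xᶜ ∩ Y).card + 2 * h := by exact_mod_cast h6
    linarith
  have h8 : (h : ℝ) * (Fintype.card V - 2 * h) ≤ h * (Xᶜ ∩ Y).card :=
    mul_le_mul_of_nonneg_left h4 (Nat.cast_nonneg h)
  rw [← sum_add_sum_compl X]
  nlinarith

end SimpleGraph

/-! ### Combining the two bounds -/

theorem theorem2p8 {V : Type*} [Fintype V] [DecidableEq V]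
    (G : SimpleGraph V) [DecidableRel G.Adj] (n : ℕ) (hcard : Fintype.card V = n)
    (hn : 4 ≤ n) (hconn : G.Connected) (hδ : 2 ≤ G.minDegree)
    (hρ : G.distSignlessSpectralRadius ≤ (2 * (n : ℝ) ^ 2 + 6 * (n : ℝ) - 28) / (n : ℝ)) :
    ∀ x : V, G.TraceableFrom x := by
  by_cases hex : ∃ f, G.IsCycleEnum f
  · obtain ⟨f, hf⟩ := hex
    exact hf.traceableFrom
  push Not at hex
  exfalso
  obtain ⟨h, X, Y, hδh, hhn, hX, hXdeg, hY, hYdeg⟩ :=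
    G.exists_degree_le_of_forall_not_isCycleEnum (by omega) hex
  have hD := SimpleGraph.sum_degree_le_of_degree_le hX hXdeg hY hYdeg
  have hray := fun (A : Finset V) (ε : ℝ) (hε : 0 ≤ ε) => hconn.rayleigh_le A hε
  rw [hcard] at hhn hY hYdeg hD
  simp only [hcard] at hray
  have hn0 : (4 : ℝ) ≤ n := by exact_mod_cast hn
  have hh2 : (2 : ℝ) ≤ h := by exact_mod_cast hδ.trans hδh
  have hhn' : 2 * (h : ℝ) + 1 ≤ n := by exact_mod_cast hhn
  set D := ∑ u, (G.degree u : ℝ) with hDdef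
  set R : ℝ := (2 * (n : ℝ) ^ 2 + 6 * (n : ℝ) - 28) / (n : ℝ)
  have hRn : R * n = 2 * (n : ℝ) ^ 2 + 6 * n - 28 := div_mul_cancel₀ _ (by positivity)
  -- The sum of all transmissions bounds the degree sum from below.
  have hDlow : (n : ℝ) ^ 2 - 5 * n + 14 ≤ D := by
    have h1 := hray ∅ 0 le_rfl
    have h2 := mul_le_mul_of_nonneg_right hρ (by positivity : (0 : ℝ) ≤ n)
    simp only [zero_mul, ne_eq, OfNat.ofNat_ne_zero, not_false_eq_true, zero_pow, add_zero,
      mul_zero] at h1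
    linarith
  by_cases hcase : h = 2 ∨ 3 * h + 7 ≤ 2 * n
  · -- The allowed degree sum is now at most the lower bound just found, so the constant vector
    -- attains the assumed bound for the spectral radius. The transmissions on `X` exceed half that
    -- bound, so raising the vector on `X` by `ε = 1 / n` gives a larger Rayleigh quotient.
    have hDle : D ≤ (n : ℝ) ^ 2 - 5 * n + 14 := by
      have hprod : ((h : ℝ) - 2) * (3 * h + 7 - 2 * n) ≤ 0 := by
        rcases hcase with rfl | hcase
        · norm_num
        · have : 3 * (h : ℝ) + 7 ≤ 2 * n := by exact_mod_cast hcase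
          exact mul_nonpos_of_nonneg_of_nonpos (by linarith) (by linarith)
      linarith
    have hdX : ∑ u ∈ X, (G.degree u : ℝ) ≤ h * h := by
      have := sum_le_card_nsmul X (fun u => (G.degree u : ℝ)) h
        fun w hw => by exact_mod_cast hXdeg w hw
      rwa [hX, nsmul_eq_mul] at this
    have heX := G.sum_sum_adj_le_sum_degree X
    set E := ∑ u ∈ X, ∑ v ∈ X, if G.Adj u v then (1 : ℝ) else 0
    set DX := ∑ u ∈ X, (G.degree u : ℝ)
    have hε : (0 : ℝ) ≤ 1 / n := by positivity
    have h1 := hray X (1 / n) hε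
    rw [hX] at h1
    have h2 := mul_le_mul_of_nonneg_right hρ
      (by positivity : (0 : ℝ) ≤ n + (2 * (1 / n) + (1 / (n : ℝ)) ^ 2) * h)
    have h3 : (1 / (n : ℝ)) * ((8 * n - 8) * h - 4 * (h * h))
        + (1 / (n : ℝ)) ^ 2 * ((2 * n - 4) * h)
        ≤ R * ((2 * (1 / n) + (1 / (n : ℝ)) ^ 2) * h) := by
      have h4 : (1 / (n : ℝ)) * (4 * (h * h - DX)) ≥ 0 :=
        mul_nonneg hε (by linarith)
      have h5 : (1 / (n : ℝ)) ^ 2 * (2 * (h * h) - DX - E) ≥ 0 :=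
        mul_nonneg (sq_nonneg _) (by linarith)
      linarith
    have h6 : ((8 * (n : ℝ) - 8) - 4 * h) * n ^ 2 + (2 * n - 4) * n ≤ (R * n) * (2 * n + 1) := by
      have h7 := mul_le_mul_of_nonneg_left h3 (by positivity : (0 : ℝ) ≤ (n : ℝ) ^ 3 / h)
      have e1 : (n : ℝ) ^ 3 / h * ((1 / (n : ℝ)) * ((8 * n - 8) * h - 4 * (h * h))
          + (1 / (n : ℝ)) ^ 2 * ((2 * n - 4) * h))
          = ((8 * (n : ℝ) - 8) - 4 * h) * n ^ 2 + (2 * n - 4) * n := by field_simp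
      have e2 : (n : ℝ) ^ 3 / h * (R * ((2 * (1 / n) + (1 / (n : ℝ)) ^ 2) * h))
          = (R * n) * (2 * n + 1) := by field_simp
      rwa [e1, e2] at h7
    rw [hRn] at h6
    have h8 : 4 * (h : ℝ) * n ^ 2 ≤ (2 * n - 2) * n ^ 2 :=
      mul_le_mul_of_nonneg_right (by linarith) (sq_nonneg _)
    nlinarith [sq_nonneg ((n : ℝ) - 9 / 2)]
  · -- Only `(n, h) = (7, 3)` and `(9, 4)` remain. There `Y` consists of `h + 1` vertices of degree
    -- at most `h`, and the test vector with entries `2` on `Y` and `1` elsewhere suffices.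
    have hYdeg' : ∀ w ∈ Y, G.degree w ≤ n - 1 - h := fun w hw => by
      have := hYdeg w hw
      omega
    have hDY := sum_le_card_nsmul Y (fun u => (G.degree u : ℝ)) ((n - 1 - h : ℕ) : ℝ)
      fun w hw => by exact_mod_cast hYdeg' w hw
    have hDE := G.sum_degree_le_of_finset Y
    have hYc : Yᶜ.card = h := by
      rw [card_compl, hcard]
      omega
    have h1 := hray Y 1 zero_le_one
    rw [hYc, ← hDdef] at hDE
    rw [nsmul_eq_mul] at hDY
    obtain ⟨rfl, rfl⟩ | ⟨rfl, rfl⟩ : (n = 7 ∧ h = 3) ∨ (n = 9 ∧ h = 4) := by omega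
    · have hYcard : Y.card = 4 := by omega
      rw [hYcard] at h1 hDY
      norm_num at h1 hDY hDE hD hρ
      linarith
    · have hYcard : Y.card = 5 := by omega
      rw [hYcard] at h1 hDY
      norm_num at h1 hDY hDE hD hρ
      linarith
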